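/- Let $n\ge 0$ be an integer. The type $B$ permutohedron $\operatorname{Perm}(B_n)$ is the convex hull in $\mathbb{R}^n$ of all points $(\pm\pi(1),\pm\pi(2),\ldots,\pm\pi(n))$, where $\pi$ runs over the permutations of $[1,n]=\{1,\ldots,n\}$ and the signs are arbitrary. Its dual is the polar dual $\{y\in\mathbb{R}^n : \langle x,y\rangle\le 1 \text{ for all } x\in\operatorname{Perm}(B_n)\}$. Let $P([1,n])$ be the Boolean algebra of all subsets of $[1,n]$, ordered by inclusion, and let $\widehat I(P([1,n]))$ be the poset of all intervals $[X,Y]=\{Z : X\subseteq Z\subseteq Y\}$ of $P([1,n])$, including the empty interval $\emptyset$, ordered by inclusion. Let $Q_n=\widehat I(P([1,n]))\setminus\{\emptyset,[\emptyset,[1,n]]\}$. The order complex $\triangle(Q_n)$ is the simplicial complex whose vertices are the elements of $Q_n$ and whose faces are the chains of $Q_n$. Then: 1. The dual of $\operatorname{Perm}(B_n)$ is a simplicial polytope, that is, a polytope all of whose proper faces are simplices. 2. The boundary complex of the dual of $\operatorname{Perm}(B_n)$ (the simplicial complex whose faces are the vertex sets of its proper faces) is combinatorially equivalent to $\triangle(Q_n)$: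 there is a bijection between the vertices of the two complexes under which faces correspond to faces. 3. There is a bijection $[X,Y]\mapsto F_{[X,Y]}$ from $Q_n$ onto the set of facets (the nonempty faces of codimension one) of $\operatorname{Perm}(B_n)$ such that, for every finite set $\{[X_1,Y_1],\ldots,[X_m,Y_m]\}\subseteq Q_n$, the intersection $F_{[X_1,Y_1]}\cap\cdots\cap F_{[X_m,Y_m]}$ is nonempty if and only if $\{[X_1,Y_1],\ldots,[X_m,Y_m]\}$ is a chain in $Q_n$. -/

import Mathlib

open scoped RealInnerProductSpace

section Polytopes

variable {E : Type*} [NormedAddCommGroup E] [InnerProductSpace ℝ E]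

/-- A (convex) polytope: the convex hull of a finite set of points. -/
def IsPolytope (P : Set E) : Prop :=
  ∃ V : Set E, V.Finite ∧ P = convexHull ℝ V

/-- A proper face of `P`: the empty set, or the set of points of `P` at which some linear
functional attains its maximum over `P`, provided that this is not all of `P`. -/
def IsProperFace (P F : Set E) : Prop :=
  IsExposed ℝ P F ∧ F ≠ P

/-- A facet of `P`: a nonempty face of dimension `dim P - 1`. -/
def IsFacet (P F : Set E) : Prop :=
  IsExposed ℝ P F ∧ F.Nonempty ∧
    Module.finrank ℝ (vectorSpan ℝ F) + 1 = Module.finrank ℝ (vectorSpan ℝ P)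

/-- A simplex: the convex hull of a finite affinely independent set
(the empty simplex is allowed). -/
def IsSimplex (F : Set E) : Prop :=
  ∃ s : Finset E, AffineIndependent ℝ ((↑) : s → E) ∧ F = convexHull ℝ (s : Set E)

/-- A simplicial polytope: a polytope all of whose proper faces are simplices. -/
structure IsSimplicialPolytope (P : Set E) : Prop where
  isPolytope : IsPolytope P
  isSimplex_of_isProperFace : ∀ F : Set E, IsProperFace P F → IsSimplex F

/-- The (polar) dual `{y | ⟪x, y⟫ ≤ 1 for all x ∈ P}` of a polytope `P` that contains the
origin in its interior. -/
def dualPolytope (P : Set E) : Set E :=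
  {y | ∀ x ∈ P, ⟪x, y⟫ ≤ 1}

/-- `K` is the boundary complex of the polytope `P`: the faces of `K` are precisely the vertex
sets of the nonempty proper faces of `P`. -/
def IsBoundaryComplex (P : Set E) (K : Geometry.SimplicialComplex ℝ E) : Prop :=
  ∀ s : Finset E, s ∈ K.faces ↔
    s.Nonempty ∧ ∃ F : Set E, IsProperFace P F ∧ (s : Set E) = F.extremePoints ℝ

end Polytopes

section Complexes

/-- The vertices of a simplicial complex. -/
abbrev ComplexVertex {V : Type*} (K : PreAbstractSimplicialComplex V) : Type _ :=
  {v : V // {v} ∈ K.faces}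

/-- Two simplicial complexes are combinatorially equivalent if there is a bijection between
their vertices under which faces correspond to faces. -/
def CombinatoriallyEquivalent {V W : Type*} (K : PreAbstractSimplicialComplex V)
    (L : PreAbstractSimplicialComplex W) : Prop :=
  ∃ e : ComplexVertex K ≃ ComplexVertex L, ∀ s : Finset (ComplexVertex K),
    s.map (Function.Embedding.subtype _) ∈ K.faces ↔
      (s.map e.toEmbedding).map (Function.Embedding.subtype _) ∈ L.faces

/-- The order complex of a poset: its vertices are the elements, its faces are the (nonempty)
finite chains. -/
def orderComplex (P : Type*) [PartialOrder P] : AbstractSimplicialComplex P where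
  faces := {s | s.Nonempty ∧ IsChain (· ≤ ·) (s : Set P)}
  isRelLowerSet_faces := by
    rintro s ⟨hs, hc⟩
    exact ⟨hs, fun t hts ht => ⟨ht, hc.mono (Finset.coe_subset.2 hts)⟩⟩
  singleton_mem v := ⟨Finset.singleton_nonempty v, by simp⟩

/-- The graded poset of intervals of `P`: all closed intervals of `P`, including the empty one
(which is `⊥`), ordered by inclusion. -/
abbrev GrI (P : Type*) [PartialOrder P] : Type _ := Interval P

/-- The graded poset of intervals of the Boolean algebra of subsets of an `n`-element set,
without its least element `∅` and its greatest element `[∅, [1,n]]`. -/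
abbrev ProperInterval (n : ℕ) : Type :=
  {I : GrI (Finset (Fin n)) //
    I ≠ ⊥ ∧ I ≠ ((⟨(∅, Finset.univ), Finset.empty_subset _⟩ :
      NonemptyInterval (Finset (Fin n))) : Interval (Finset (Fin n)))}

end Complexes

/-- The type `B` permutohedron: the convex hull of all points `(± π(1), …, ± π(n))`, where `π` is
a permutation of `{1, …, n}` and the signs are arbitrary. Here `Fin n` stands for `{1, …, n}`,
the element `i` of `Fin n` being identified with the number `i + 1`. -/
def permB (n : ℕ) : Set (EuclideanSpace ℝ (Fin n)) :=
  convexHull ℝ {v | ∃ (π : Equiv.Perm (Fin n)) (ε : Fin n → ℤˣ),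
    ∀ i, v i = ((ε i : ℤ) : ℝ) * (((π i : ℕ) : ℝ) + 1)}

/-! An interval `[X, Y]` is encoded as the sign vector equal to 1 on `X`, 0 on `Y \ X` and -1 off
`Y`. This identifies `ProperInterval n` with the nonzero sign vectors, and a smaller interval is one
whose sign vector prescribes more nonzero entries. Dividing each sign vector by its maximum over
`permB n`, a sum of largest numbers among 1, …, n, gives the vectors `dualVertex I`.

Everything rests on three facts, collected in `IsPolarSystem`: these vectors pair with `permB n` to
at most 1; for each chain some point of `permB n` attains 1 exactly on that chain
(`exists_supporting_permB`); and every vector is a nonnegative combination of a chain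
(`exists_coeff_signVector`). The second comes from averaging well-chosen signed permutations, the
third from peeling a vector into layers of constant absolute value.

The rest is formal. The combination with chain support makes the dual the convex hull of 0 and the
`v I`; supporting points show that chains are linearly independent and span exposed faces; comparing
the two shows that vectors on a common proper face form a chain. Facets of `P` are the loci `⟪x, v
I⟫ = 1`, and they meet exactly along chains. -/

/-! ### Polytopes whose normal fan is indexed by the chains of a finite poset. -/

section PolarSystem

variable {E : Type*} [NormedAddCommGroup E] [InnerProductSpace ℝ E]
  {Q : Type*} [PartialOrder Q] [Fintype Q]

omit [PartialOrder Q] in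
/-- The points of the convex hull of a part of a finite family are its convex combinations. -/
theorem mem_convexHull_image_iff (v : Q → E) (T : Set Q) (y : E) :
    y ∈ convexHull ℝ (v '' T) ↔
      ∃ c : Q → ℝ, (∀ I, 0 ≤ c I) ∧ (∀ I, c I ≠ 0 → I ∈ T) ∧ ∑ I, c I = 1 ∧
        ∑ I, c I • v I = y := by
  classical
  constructor
  · have hconv : Convex ℝ {y : E | ∃ c : Q → ℝ, (∀ I, 0 ≤ c I) ∧ (∀ I, c I ≠ 0 → I ∈ T) ∧
        ∑ I, c I = 1 ∧ ∑ I, c I • v I = y} := by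
      rintro _ ⟨c, hc, hcT, hc1, rfl⟩ _ ⟨d, hd, hdT, hd1, rfl⟩ a b ha hb hab
      refine ⟨fun I => a * c I + b * d I, fun I => ?_, fun I hI => ?_, ?_, ?_⟩
      · have := hc I; have := hd I; positivity
      · by_contra hIT
        have h1 : c I = 0 := by_contra fun h => hIT (hcT I h)
        have h2 : d I = 0 := by_contra fun h => hIT (hdT I h)
        simp [h1, h2] at hI
      · rw [Finset.sum_add_distrib, ← Finset.mul_sum, ← Finset.mul_sum, hc1, hd1]; linarith
      · simp only [add_smul, mul_smul, Finset.sum_add_distrib, Finset.smul_sum]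
    intro hy
    refine convexHull_min ?_ hconv hy
    rintro _ ⟨I, hI, rfl⟩
    refine ⟨Pi.single I 1, fun J => ?_, fun J hJ => ?_, by simp, ?_⟩
    · by_cases h : J = I
      · subst h; simp
      · simp [h]
    · by_cases h : J = I
      · exact h ▸ hI
      · simp [h] at hJ
    · rw [Finset.sum_eq_single I] <;> simp +contextual
  · rintro ⟨c, hc, hcT, hc1, rfl⟩
    have hsub : ∑ I, c I • v I = ∑ I ∈ Finset.univ.filter (· ∈ T), c I • v I := by
      symm
      refine Finset.sum_subset (Finset.subset_univ _) fun I _ hI => ?_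
      have : c I = 0 := by_contra fun h => hI (by simpa using hcT I h)
      simp [this]
    have hsub1 : ∑ I, c I = ∑ I ∈ Finset.univ.filter (· ∈ T), c I := by
      symm
      refine Finset.sum_subset (Finset.subset_univ _) fun I _ hI => ?_
      exact by_contra fun h => hI (by simpa using hcT I h)
    rw [hsub]
    refine (convex_convexHull ℝ _).sum_mem (fun I _ => hc I) (hsub1 ▸ hc1) fun I hI => ?_
    exact subset_convexHull ℝ _ ⟨I, by simpa using hI, rfl⟩

omit [PartialOrder Q] in
/-- If a convex combination of numbers bounded by `M` is at least `M`, then only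
the numbers equal to `M` have a nonzero weight. -/
theorem eq_of_le_sum_mul {c f : Q → ℝ} {M : ℝ} (hc : ∀ I, 0 ≤ c I) (hf : ∀ I, f I ≤ M)
    (h : M * ∑ I, c I ≤ ∑ I, c I * f I) {I : Q} (hI : c I ≠ 0) : f I = M := by
  have h0 : ∑ I, c I * (M - f I) = 0 := by
    refine le_antisymm ?_ (Finset.sum_nonneg fun J _ => mul_nonneg (hc J) (by linarith [hf J]))
    simp only [mul_sub, Finset.sum_sub_distrib, ← Finset.sum_mul]
    linarith [mul_comm M (∑ I, c I)]
  have := (Finset.sum_eq_zero_iff_of_nonneg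
    fun J _ => mul_nonneg (hc J) (by linarith [hf J])).1 h0 I (Finset.mem_univ I)
  rcases mul_eq_zero.1 this with h | h
  · exact absurd h hI
  · linarith

omit [PartialOrder Q] in
theorem sum_mul_le_mul_sum {c f : Q → ℝ} {M : ℝ} (hc : ∀ I, 0 ≤ c I) (hf : ∀ I, f I ≤ M) :
    ∑ I, c I * f I ≤ M * ∑ I, c I := by
  rw [Finset.mul_sum]
  exact Finset.sum_le_sum fun I _ => by nlinarith [hc I, hf I]

/-- The vectors `v I` are outer normals, normalized to the value one, of the set `P`, such
that the cones spanned by the chains of `Q` are the cones of the normal fan of `P`. -/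
structure IsPolarSystem (P : Set E) (v : Q → E) : Prop where
  inner_le_one : ∀ x ∈ P, ∀ I, ⟪x, v I⟫ ≤ 1
  exists_supporting : ∀ C : Set Q, IsChain (· ≤ ·) C → ∃ x ∈ P, ∀ I, ⟪x, v I⟫ = 1 ↔ I ∈ C
  exists_coeff : ∀ y : E, ∃ c : Q → ℝ, (∀ I, 0 ≤ c I) ∧
    IsChain (· ≤ ·) {I | c I ≠ 0} ∧ ∑ I, c I • v I = y

namespace IsPolarSystem

variable {P : Set E} {v : Q → E} (h : IsPolarSystem P v)
include h

theorem inner_sum_le {x : E} (hx : x ∈ P) {c : Q → ℝ} (hc : ∀ I, 0 ≤ c I) :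
    ⟪x, ∑ I, c I • v I⟫ ≤ ∑ I, c I := by
  simp only [inner_sum, inner_smul_right]
  simpa using sum_mul_le_mul_sum hc (h.inner_le_one x hx)

omit h [PartialOrder Q] in
theorem inner_sum_eq {x : E} {c : Q → ℝ} (hx : ∀ I, c I ≠ 0 → ⟪x, v I⟫ = 1) :
    ⟪x, ∑ I, c I • v I⟫ = ∑ I, c I := by
  simp only [inner_sum, inner_smul_right]
  refine Finset.sum_congr rfl fun I _ => ?_
  by_cases hI : c I = 0
  · simp [hI]
  · rw [hx I hI, mul_one]

theorem injective : Function.Injective v := by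
  intro I J hIJ
  obtain ⟨x, hx, hxC⟩ := h.exists_supporting {I} IsChain.singleton
  have h1 := (hxC I).2 rfl
  rw [hIJ] at h1
  exact ((hxC J).1 h1).symm

/-- The elements at which a linear functional attains its positive maximum form a chain. -/
theorem isChain_of_le (l : E →ₗ[ℝ] ℝ) {M : ℝ} (hM : 0 < M) (hl : ∀ I, l (v I) ≤ M) :
    IsChain (· ≤ ·) {I | l (v I) = M} := by
  intro I hI J hJ hne
  -- Expand `v I + v J` along a chain. Applying `l` shows that the coefficients sum to at least 2,
  -- and this sum is the value of `v I + v J` at the supporting point `x`. Each summand is at most 1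
  -- there, so both equal 1 and `I`, `J` lie in the chain.
  obtain ⟨c, hc, hC, hsum⟩ := h.exists_coeff (v I + v J)
  obtain ⟨x, hx, hxC⟩ := h.exists_supporting _ hC
  have h1 := inner_sum_eq (x := x) (v := v) (c := c) fun K hK => (hxC K).2 hK
  rw [hsum, inner_add_right] at h1
  have h2 := congrArg l hsum
  simp only [map_sum, map_smul, map_add, smul_eq_mul] at h2
  have h3 := sum_mul_le_mul_sum hc hl
  have hI' : l (v I) = M := hI
  have hJ' : l (v J) = M := hJ
  have h4 : 2 ≤ ∑ K, c K := by
    by_contra! hlt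
    nlinarith
  have h5 := h.inner_le_one x hx I
  have h6 := h.inner_le_one x hx J
  exact hC ((hxC I).1 (by linarith)) ((hxC J).1 (by linarith)) hne

theorem isChain_of_mem {x : E} (hx : x ∈ P) : IsChain (· ≤ ·) {I | ⟪x, v I⟫ = 1} :=
  h.isChain_of_le (innerₗ E x) one_pos fun I => h.inner_le_one x hx I

/-- The supporting points of `C` and of `C \ {J}` give equal values on every other member of `C` and
different values on `v J`, so pairing a relation with their difference isolates the coefficient of
`J`. -/
theorem linearIndepOn {C : Set Q} (hC : IsChain (· ≤ ·) C) : LinearIndepOn ℝ v C := by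
  classical
  rw [linearIndepOn_iff]
  intro a ha hsum
  rw [Finsupp.mem_supported] at ha
  rw [Finsupp.linearCombination_apply, Finsupp.sum_fintype _ _ (by simp)] at hsum
  have haC : ∀ I, a I ≠ 0 → I ∈ C := fun I hI => ha (by simpa using hI)
  have key : ∀ x : E, ∑ I, a I * ⟪x, v I⟫ = 0 := fun x => by
    have := congrArg (fun y => ⟪x, y⟫) hsum
    simpa [inner_sum, inner_smul_right] using this
  ext J
  by_contra hJ
  simp only [Finsupp.coe_zero, Pi.zero_apply] at hJ
  obtain ⟨x, -, hxC⟩ := h.exists_supporting C hC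
  obtain ⟨x', -, hxC'⟩ := h.exists_supporting (C \ {J}) (hC.mono Set.sdiff_subset)
  have hne : ⟪x', v J⟫ ≠ 1 := fun hh => by simpa using (hxC' J).1 hh
  have h1 : ∑ I, a I * (⟪x, v I⟫ - ⟪x', v I⟫) = 0 := by
    simp only [mul_sub, Finset.sum_sub_distrib, key, sub_zero]
  rw [Finset.sum_eq_single J] at h1
  · rw [(hxC J).2 (haC J hJ)] at h1
    rcases mul_eq_zero.1 h1 with h2 | h2
    · exact hJ h2
    · exact hne (by linarith)
  · intro I _ hIJ
    by_cases hI : a I = 0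
    · simp [hI]
    · rw [(hxC I).2 (haC I hI), (hxC' I).2 ⟨haC I hI, hIJ⟩]; simp
  · simp

theorem affineIndependent {C : Set Q} (hC : IsChain (· ≤ ·) C) {s : Finset E}
    (hs : (s : Set E) = v '' C) : AffineIndependent ℝ ((↑) : s → E) := by
  have h1 : LinearIndepOn ℝ id (s : Set E) := hs ▸ (h.linearIndepOn hC).id_image
  exact LinearIndependent.affineIndependent (k := ℝ) h1

/-! ### The dual polytope -/

theorem mem_dual (I : Q) : v I ∈ dualPolytope P := fun x hx => h.inner_le_one x hx I

omit h [PartialOrder Q] [Fintype Q] in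
theorem zero_mem_dual : (0 : E) ∈ dualPolytope P := fun x _ => by simp

omit h in
theorem convex_dual : Convex ℝ (dualPolytope P) := by
  intro y hy z hz a b ha hb hab x hx
  rw [inner_add_right, inner_smul_right, inner_smul_right]
  nlinarith [hy x hx, hz x hx]

theorem sum_le_one {c : Q → ℝ} (hC : IsChain (· ≤ ·) {I | c I ≠ 0})
    (hy : ∑ I, c I • v I ∈ dualPolytope P) : ∑ I, c I ≤ 1 := by
  obtain ⟨x, hx, hxC⟩ := h.exists_supporting _ hC
  rw [← inner_sum_eq (x := x) (v := v) (c := c) fun K hK => (hxC K).2 hK]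
  exact hy x hx

theorem dual_eq_convexHull : dualPolytope P = convexHull ℝ (insert 0 (Set.range v)) := by
  apply subset_antisymm
  · intro y hy
    obtain ⟨c, hc, hC, rfl⟩ := h.exists_coeff y
    have h1 := h.sum_le_one hC hy
    have hmem : ∀ i : Option Q, i.elim 0 v ∈ convexHull ℝ (insert 0 (Set.range v)) := by
      intro i
      apply subset_convexHull
      cases i <;> simp
    -- The index `none` stands for the origin, which takes up the missing weight `1 - ∑ c`.
    have := (convex_convexHull ℝ (insert 0 (Set.range v))).sum_mem (t := Finset.univ)
      (w := fun i : Option Q => i.elim (1 - ∑ I, c I) c) (z := fun i => i.elim 0 v)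
      (fun i _ => by cases i <;> simp [hc, h1]) (by simp [Fintype.sum_option])
      (fun i _ => hmem i)
    simpa [Fintype.sum_option] using this
  · refine convexHull_min ?_ convex_dual
    rintro _ (rfl | ⟨I, rfl⟩)
    · exact zero_mem_dual
    · exact h.mem_dual I

theorem isPolytope_dual : IsPolytope (dualPolytope P) :=
  ⟨_, (Set.finite_range v).insert 0, h.dual_eq_convexHull⟩

/-- The part of the dual where a functional attains its positive maximum. -/
theorem dual_inter_eq (l : E →ₗ[ℝ] ℝ) {M : ℝ} (hM : 0 < M) (hl : ∀ I, l (v I) ≤ M) :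
    {y ∈ dualPolytope P | M ≤ l y} = convexHull ℝ (v '' {I | l (v I) = M}) := by
  apply subset_antisymm
  · rintro y ⟨hy, hMy⟩
    obtain ⟨c, hc, hC, rfl⟩ := h.exists_coeff y
    have h1 := h.sum_le_one hC hy
    simp only [map_sum, map_smul, smul_eq_mul] at hMy
    have h2 := sum_mul_le_mul_sum hc hl
    have h3 : ∑ I, c I = 1 := by
      refine le_antisymm h1 ?_
      by_contra! hlt
      nlinarith
    rw [mem_convexHull_image_iff]
    exact ⟨c, hc, fun I hI => eq_of_le_sum_mul hc hl (by rw [h3]; linarith) hI, h3, rfl⟩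
  · refine convexHull_min ?_ (convex_dual.inter (convex_halfSpace_ge l.isLinear M))
    rintro _ ⟨I, hI, rfl⟩
    exact ⟨h.mem_dual I, le_of_eq (Eq.symm hI)⟩

theorem dual_inter_supporting {C : Set Q} {x : E} (hx : x ∈ P) (hxC : ∀ I, ⟪x, v I⟫ = 1 ↔ I ∈ C) :
    {y ∈ dualPolytope P | 1 ≤ ⟪x, y⟫} = convexHull ℝ (v '' C) := by
  have := h.dual_inter_eq (innerₗ E x) one_pos fun I => h.inner_le_one x hx I
  simpa [hxC] using this

theorem isExposed_convexHull {C : Set Q} (hC : IsChain (· ≤ ·) C) :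
    IsExposed ℝ (dualPolytope P) (convexHull ℝ (v '' C)) := by
  intro hne
  obtain ⟨x, hx, hxC⟩ := h.exists_supporting C hC
  refine ⟨innerSL ℝ x, ?_⟩
  rw [← h.dual_inter_supporting hx hxC] at hne ⊢
  obtain ⟨z, hz, hz1⟩ := hne
  ext y
  constructor
  · rintro ⟨hy, hy1⟩
    exact ⟨hy, fun w hw => by simpa using (hw x hx).trans hy1⟩
  · rintro ⟨hy, hy1⟩
    exact ⟨hy, hz1.trans (by simpa using hy1 z hz)⟩

theorem isProperFace_convexHull {C : Set Q} (hC : IsChain (· ≤ ·) C) :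
    IsProperFace (dualPolytope P) (convexHull ℝ (v '' C)) := by
  refine ⟨h.isExposed_convexHull hC, fun heq => ?_⟩
  obtain ⟨x, hx, hxC⟩ := h.exists_supporting C hC
  have h0 : (0 : E) ∈ dualPolytope P := zero_mem_dual
  rw [← heq, ← h.dual_inter_supporting hx hxC] at h0
  have := h0.2
  simp at this
  linarith

/-- A functional defining a nonempty proper face has a positive maximum: since the `v I` positively
span the space, maximum zero would make it vanish identically and the face would be the whole dual.
Positivity makes the maximizing indices a chain. -/
theorem exists_chain_of_isProperFace {F : Set E} (hF : IsProperFace (dualPolytope P) F) :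
    ∃ C : Set Q, IsChain (· ≤ ·) C ∧ F = convexHull ℝ (v '' C) := by
  obtain ⟨hexp, hne⟩ := hF
  rcases F.eq_empty_or_nonempty with rfl | hFne
  · exact ⟨∅, IsChain.empty, by simp⟩
  obtain ⟨l, hl⟩ := hexp hFne
  obtain ⟨y, hy⟩ := hFne
  rw [hl] at hy
  have hmax : ∀ I, l (v I) ≤ l y := fun I => hy.2 _ (h.mem_dual I)
  have h0 : 0 ≤ l y := by simpa using hy.2 0 zero_mem_dual
  have hpos : 0 < l y := by
    refine lt_of_le_of_ne h0 fun heq => hne ?_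
    have hle : ∀ z, l z ≤ 0 := fun z => by
      obtain ⟨c, hc, -, rfl⟩ := h.exists_coeff z
      simp only [map_sum, map_smul, smul_eq_mul]
      refine Finset.sum_nonpos fun I _ => mul_nonpos_of_nonneg_of_nonpos (hc I) ?_
      rw [heq]; exact hmax I
    have hz : ∀ z, l z = 0 := fun z =>
      le_antisymm (hle z) (by have := hle (-z); rw [map_neg] at this; linarith)
    rw [hl]
    ext z
    simp [hz]
  refine ⟨_, h.isChain_of_le l.toLinearMap hpos hmax, ?_⟩
  rw [← h.dual_inter_eq l.toLinearMap hpos hmax, hl]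
  ext z
  constructor
  · rintro ⟨hz, hz1⟩
    exact ⟨hz, hz1 y hy.1⟩
  · rintro ⟨hz, hz1⟩
    exact ⟨hz, fun w hw => (hy.2 w hw).trans hz1⟩

theorem isSimplex_convexHull {C : Set Q} (hC : IsChain (· ≤ ·) C) :
    IsSimplex (convexHull ℝ (v '' C)) := by
  have hfin : (v '' C).Finite := (Set.toFinite C).image v
  exact ⟨hfin.toFinset, h.affineIndependent hC (by simp), by simp⟩

theorem isSimplicialPolytope_dual : IsSimplicialPolytope (dualPolytope P) := by
  refine ⟨h.isPolytope_dual, fun F hF => ?_⟩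
  obtain ⟨C, hC, rfl⟩ := h.exists_chain_of_isProperFace hF
  exact h.isSimplex_convexHull hC

/-- Each `v I` is itself the exposed face of the chain `{I}`, hence extreme in the whole dual. -/
theorem extremePoints_convexHull {C : Set Q} (hC : IsChain (· ≤ ·) C) :
    (convexHull ℝ (v '' C)).extremePoints ℝ = v '' C := by
  refine subset_antisymm extremePoints_convexHull_subset ?_
  rintro _ ⟨I, hI, rfl⟩
  refine inter_extremePoints_subset_extremePoints_of_subset
    (h.isExposed_convexHull hC).subset ⟨subset_convexHull ℝ _ ⟨I, hI, rfl⟩, ?_⟩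
  have := h.isExposed_convexHull (C := {I}) IsChain.singleton
  rw [Set.image_singleton, convexHull_singleton] at this
  exact isExtreme_singleton.1 this.isExtreme

theorem convexHull_inter_subset {C D : Set Q} (hC : IsChain (· ≤ ·) C) :
    convexHull ℝ (v '' C) ∩ convexHull ℝ (v '' D) ⊆ convexHull ℝ (v '' (C ∩ D)) := by
  rintro y ⟨hyC, hyD⟩
  obtain ⟨x, hx, hxC⟩ := h.exists_supporting C hC
  rw [← h.dual_inter_supporting hx hxC] at hyC
  rw [mem_convexHull_image_iff] at hyD ⊢
  obtain ⟨c, hc, hcD, hc1, rfl⟩ := hyD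
  refine ⟨c, hc, fun I hI => ⟨(hxC I).1 ?_, hcD I hI⟩, hc1, rfl⟩
  refine eq_of_le_sum_mul hc (h.inner_le_one x hx) ?_ hI
  have := hyC.2
  simp only [inner_sum, inner_smul_right] at this
  linarith

/-- The boundary complex of the dual polytope. -/
def boundaryComplex : Geometry.SimplicialComplex ℝ E where
  faces := {s | s.Nonempty ∧ ∃ C : Set Q, IsChain (· ≤ ·) C ∧ (s : Set E) = v '' C}
  isRelLowerSet_faces := by
    rintro s ⟨hs, C, hC, hsC⟩
    refine ⟨hs, fun t hts ht => ⟨ht, C ∩ v ⁻¹' t, hC.mono Set.inter_subset_left, ?_⟩⟩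
    rw [Set.image_inter_preimage, ← hsC]
    exact (Set.inter_eq_right.2 (Finset.coe_subset.2 hts)).symm
  indep := by
    rintro s ⟨-, C, hC, hsC⟩
    exact h.affineIndependent hC hsC
  inter_subset_convexHull := by
    rintro s t ⟨-, C, hC, hsC⟩ ⟨-, D, -, htD⟩
    rw [hsC, htD, ← Set.image_inter h.injective]
    exact h.convexHull_inter_subset hC

theorem isBoundaryComplex_boundaryComplex :
    IsBoundaryComplex (dualPolytope P) h.boundaryComplex := by
  intro s
  refine and_congr_right fun _ => ⟨?_, ?_⟩
  · rintro ⟨C, hC, hsC⟩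
    exact ⟨_, h.isProperFace_convexHull hC, by rw [h.extremePoints_convexHull hC, hsC]⟩
  · rintro ⟨F, hF, hsF⟩
    obtain ⟨C, hC, rfl⟩ := h.exists_chain_of_isProperFace hF
    exact ⟨C, hC, by rw [hsF, h.extremePoints_convexHull hC]⟩

theorem mem_boundaryComplex_iff (s : Finset Q) :
    s.map ⟨v, h.injective⟩ ∈ h.boundaryComplex.faces ↔ s ∈ (orderComplex Q).faces := by
  refine and_congr (by simp) ⟨?_, fun hs => ⟨s, hs, by simp⟩⟩
  rintro ⟨C, hC, hsC⟩
  rw [Finset.coe_map, Function.Embedding.coeFn_mk] at hsC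
  rwa [h.injective.image_injective hsC]

theorem combinatoriallyEquivalent :
    CombinatoriallyEquivalent h.boundaryComplex.toPreAbstractSimplicialComplex
      (orderComplex Q).toPreAbstractSimplicialComplex := by
  have hsing : ∀ I : Q, {v I} ∈ h.boundaryComplex.faces := fun I => by
    have := (h.mem_boundaryComplex_iff {I}).2 ((orderComplex Q).singleton_mem I)
    simpa using this
  let f : ComplexVertex (orderComplex Q).toPreAbstractSimplicialComplex →
      ComplexVertex h.boundaryComplex.toPreAbstractSimplicialComplex :=
    fun I => ⟨v I.1, hsing I.1⟩
  have hf : Function.Bijective f := by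
    constructor
    · intro I J hIJ
      exact Subtype.ext (h.injective (congrArg Subtype.val hIJ))
    · rintro ⟨y, hy⟩
      obtain ⟨-, C, hC, hyC⟩ := id hy
      have : y ∈ v '' C := by rw [← hyC]; simp
      obtain ⟨I, -, rfl⟩ := this
      exact ⟨⟨I, (orderComplex Q).singleton_mem I⟩, rfl⟩
  let e := Equiv.ofBijective f hf
  refine ⟨e.symm, fun s => ?_⟩
  have hs : s.map (Function.Embedding.subtype _) =
      ((s.map e.symm.toEmbedding).map (Function.Embedding.subtype _)).map ⟨v, h.injective⟩ := by
    rw [Finset.map_map, Finset.map_map]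
    refine congrArg (fun g => s.map g) ?_
    ext y
    exact congrArg Subtype.val (e.apply_symm_apply y).symm
  rw [hs]
  exact h.mem_boundaryComplex_iff _

/-! ### Facets -/

omit h [PartialOrder Q] [Fintype Q] in
theorem inner_eq_of_mem_orthogonal {F : Set E} {z : E} (hz : z ∈ (vectorSpan ℝ F)ᗮ) {x y : E}
    (hx : x ∈ F) (hy : y ∈ F) : ⟪x, z⟫ = ⟪y, z⟫ := by
  have := (Submodule.mem_orthogonal _ _).1 hz _ (vsub_mem_vectorSpan ℝ hx hy)
  rw [vsub_eq_sub, inner_sub_left] at this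
  linarith

omit h [PartialOrder Q] [Fintype Q] in
theorem mem_orthogonal_vectorSpan {F : Set E} {z : E} {a : ℝ} (hz : ∀ x ∈ F, ⟪x, z⟫ = a) :
    z ∈ (vectorSpan ℝ F)ᗮ := by
  suffices hle : vectorSpan ℝ F ≤ (ℝ ∙ z)ᗮ from
    (Submodule.mem_orthogonal _ _).2 fun w hw =>
      Submodule.mem_orthogonal_singleton_iff_inner_left.1 (hle hw)
  refine Submodule.span_le.2 ?_
  rintro _ ⟨x, hx, y, hy, rfl⟩
  refine Submodule.mem_orthogonal_singleton_iff_inner_left.2 ?_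
  change ⟪x - y, z⟫ = 0
  rw [inner_sub_left, hz x hx, hz y hy, sub_self]

/-- A vector constant on `P` takes the same value at the supporting point of its own chain, where
that value is the sum of the coefficients, and at the supporting point of `∅`, where every pairing
is below 1. So all coefficients vanish. -/
theorem orthogonal_vectorSpan_eq_bot : (vectorSpan ℝ P)ᗮ = ⊥ := by
  rw [eq_bot_iff]
  intro z hz
  obtain ⟨c, hc, hC, rfl⟩ := h.exists_coeff z
  obtain ⟨x, hx, hxC⟩ := h.exists_supporting _ hC
  obtain ⟨x', hx', hxC'⟩ := h.exists_supporting ∅ IsChain.empty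
  have h1 := inner_eq_of_mem_orthogonal hz hx' hx
  rw [inner_sum_eq (x := x) (v := v) (c := c) fun K hK => (hxC K).2 hK] at h1
  simp only [inner_sum, inner_smul_right] at h1
  have h2 : ∀ I, c I = 0 := fun I => by
    by_contra hI
    exact (hxC' I).1 (eq_of_le_sum_mul hc (h.inner_le_one x' hx') (by linarith) hI)
  simp [h2]

/-- The part of `P` cut out by the functional of index `I`. -/
def facet (_ : IsPolarSystem P v) (I : Q) : Set E := {x ∈ P | ⟪x, v I⟫ = 1}

/-- If `z` is constant on the facet, adding a large multiple of `v I` forces `I` into the chain of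
`z + t • v I`. Its supporting point then lies on the facet, so this vector has the same value at
`x₀`, where only `v I` attains 1; hence only `I` has a nonzero coefficient. -/
theorem orthogonal_vectorSpan_facet (I : Q) :
    (vectorSpan ℝ (h.facet I))ᗮ = Submodule.span ℝ {v I} := by
  apply le_antisymm
  · intro z hz
    obtain ⟨x₀, hx₀, hxI⟩ := h.exists_supporting {I} IsChain.singleton
    have hx₀I : x₀ ∈ h.facet I := ⟨hx₀, (hxI I).2 rfl⟩
    have hconst : ∀ x ∈ h.facet I, ⟪x, z⟫ = ⟪x₀, z⟫ := fun x hx =>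
      inner_eq_of_mem_orthogonal hz hx hx₀I
    choose! s hsP hs using h.exists_supporting
    -- a multiple of `v I` large enough for `I` to occur in the decomposition
    obtain ⟨t, ht⟩ : ∃ t : ℝ, ∀ C : Set Q, IsChain (· ≤ ·) C → I ∉ C →
        ⟪s C, z⟫ - ⟪x₀, z⟫ < t * (1 - ⟪s C, v I⟫) := by
      obtain ⟨t, ht⟩ := (Set.finite_range fun C : Set Q =>
        (⟪s C, z⟫ - ⟪x₀, z⟫) / (1 - ⟪s C, v I⟫)).bddAbove
      -- There are finitely many sets `C`, so the ratios are bounded by some `t`; the added 1 makes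
      -- the bound strict.
      refine ⟨t + 1, fun C hC hIC => ?_⟩
      have hlt : 0 < 1 - ⟪s C, v I⟫ := by
        have := lt_of_le_of_ne (h.inner_le_one _ (hsP C hC) I) fun hh => hIC ((hs C hC I).1 hh)
        linarith
      rw [← div_lt_iff₀ hlt]
      linarith [ht ⟨C, rfl⟩]
    obtain ⟨c, hc, hC, hsum⟩ := h.exists_coeff (z + t • v I)
    have h1 : ∑ K, c K = ⟪s {K | c K ≠ 0}, z⟫ + t * ⟪s {K | c K ≠ 0}, v I⟫ := by
      rw [← inner_sum_eq (v := v) (c := c) fun K hK => (hs _ hC K).2 hK, hsum, inner_add_right,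
        inner_smul_right]
    have h2 : ⟪x₀, z⟫ + t = ∑ K, c K * ⟪x₀, v K⟫ := by
      have := congrArg (fun y => ⟪x₀, y⟫) hsum
      simp only [inner_sum, inner_smul_right, inner_add_right, hx₀I.2] at this
      linarith
    have h3 := sum_mul_le_mul_sum hc (h.inner_le_one x₀ hx₀)
    have hIC : I ∈ {K | c K ≠ 0} := by
      by_contra hIC
      have := ht _ hC hIC
      linarith
    have hsI := (hs _ hC I).2 hIC
    rw [hsI, hconst _ ⟨hsP _ hC, hsI⟩] at h1
    have h4 : ∀ K, K ≠ I → c K = 0 := fun K hK => by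
      by_contra hcK
      exact hK ((hxI K).1 (eq_of_le_sum_mul hc (h.inner_le_one x₀ hx₀) (by linarith) hcK))
    rw [Finset.sum_eq_single I (fun K _ hK => by simp [h4 K hK]) (by simp)] at hsum
    rw [Submodule.mem_span_singleton]
    exact ⟨c I - t, by rw [sub_smul, hsum]; abel⟩
  · rw [Submodule.span_singleton_le_iff_mem]
    exact mem_orthogonal_vectorSpan fun x hx => hx.2

theorem ne_zero (I : Q) : v I ≠ 0 := by
  obtain ⟨x, -, hxI⟩ := h.exists_supporting {I} IsChain.singleton
  have := (hxI I).2 rfl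
  rintro h0
  simp [h0] at this

theorem isExposed_facet (I : Q) : IsExposed ℝ P (h.facet I) := by
  rintro ⟨x₀, hx₀⟩
  refine ⟨innerSL ℝ (v I), ?_⟩
  ext x
  simp only [innerSL_apply_apply, real_inner_comm]
  constructor
  · rintro ⟨hx, hx1⟩
    exact ⟨hx, fun y hy => hx1 ▸ h.inner_le_one y hy I⟩
  · rintro ⟨hx, hx1⟩
    exact ⟨hx, le_antisymm (h.inner_le_one x hx I) (hx₀.2 ▸ hx1 x₀ hx₀.1)⟩

theorem nonempty_facet (I : Q) : (h.facet I).Nonempty := by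
  obtain ⟨x, hx, hxI⟩ := h.exists_supporting {I} IsChain.singleton
  exact ⟨x, hx, (hxI I).2 rfl⟩

theorem facet_injective : Function.Injective h.facet := by
  intro I J hIJ
  obtain ⟨x, hx, hxI⟩ := h.exists_supporting {I} IsChain.singleton
  have : x ∈ h.facet I := ⟨hx, (hxI I).2 rfl⟩
  rw [hIJ] at this
  exact ((hxI J).1 this.2).symm

theorem iInter_facet_nonempty_iff (S : Finset Q) :
    (⋂ I ∈ S, h.facet I).Nonempty ↔ IsChain (· ≤ ·) (S : Set Q) := by
  constructor
  · rintro ⟨x, hx⟩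
    rw [Set.mem_iInter₂] at hx
    -- For empty `S` the intersection is the whole space, so `x` need not lie in `P`.
    rcases S.eq_empty_or_nonempty with rfl | ⟨I, hI⟩
    · simp
    · exact (h.isChain_of_mem (hx I hI).1).mono fun J hJ => (hx J hJ).2
  · intro hS
    obtain ⟨x, hx, hxS⟩ := h.exists_supporting S hS
    exact ⟨x, Set.mem_iInter₂.2 fun I hI => ⟨hx, (hxS I).2 hI⟩⟩

variable [FiniteDimensional ℝ E]

theorem vectorSpan_eq_top : vectorSpan ℝ P = ⊤ :=
  (Submodule.orthogonal_eq_bot_iff).1 h.orthogonal_vectorSpan_eq_bot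

theorem isFacet_facet (I : Q) : IsFacet P (h.facet I) := by
  refine ⟨h.isExposed_facet I, h.nonempty_facet I, ?_⟩
  have := Submodule.finrank_add_finrank_orthogonal (vectorSpan ℝ (h.facet I))
  rwa [h.orthogonal_vectorSpan_facet I, finrank_span_singleton (h.ne_zero I),
    ← finrank_top ℝ E, ← h.vectorSpan_eq_top] at this

/-- Expanding the functional along a chain, `F` is where all `v I` of nonzero coefficient equal 1.
Thus `F` lies in some `h.facet I`, and equal dimensions give equal orthogonal complements, a line;
any other vector used is a multiple of `v I` with value 1 on `F`, so it is `v I`. -/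
theorem exists_eq_facet {F : Set E} (hF : IsFacet P F) : ∃ I, F = h.facet I := by
  obtain ⟨hexp, hne, hdim⟩ := hF
  obtain ⟨l, hl⟩ := hexp hne
  obtain ⟨y, rfl⟩ := (InnerProductSpace.toDual ℝ E).surjective l
  obtain ⟨c, hc, hC, rfl⟩ := h.exists_coeff y
  simp only [InnerProductSpace.toDual_apply_apply, real_inner_comm] at hl
  obtain ⟨x₀, hx₀, hxC⟩ := h.exists_supporting _ hC
  have hval := inner_sum_eq (x := x₀) (v := v) (c := c) fun K hK => (hxC K).2 hK
  have hmem : ∀ x, x ∈ F ↔ x ∈ P ∧ ∀ I, c I ≠ 0 → ⟪x, v I⟫ = 1 := fun x => by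
    rw [hl]
    refine and_congr_right fun hx => ⟨fun hmax I hI => ?_, fun hall z hz => ?_⟩
    · have := hmax x₀ hx₀
      rw [hval] at this
      simp only [inner_sum, inner_smul_right] at this
      exact eq_of_le_sum_mul hc (h.inner_le_one x hx) (by linarith) hI
    · rw [inner_sum_eq hall]
      exact h.inner_sum_le hz hc
  obtain ⟨I, hI⟩ : ∃ I, c I ≠ 0 := by
    by_contra! hall
    have : F = P := by ext x; simp [hmem, hall]
    rw [this] at hdim
    omega
  have hsub : F ⊆ h.facet I := fun x hx => ⟨((hmem x).1 hx).1, ((hmem x).1 hx).2 I hI⟩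
  have hspan : vectorSpan ℝ F = vectorSpan ℝ (h.facet I) :=
    Submodule.eq_of_le_of_finrank_eq (vectorSpan_mono ℝ hsub)
      (by have := (h.isFacet_facet I).2.2; omega)
  have huniq : ∀ J, c J ≠ 0 → J = I := fun J hJ => by
    have hJ1 : ∀ x ∈ F, ⟪x, v J⟫ = 1 := fun x hx => ((hmem x).1 hx).2 J hJ
    have hm : v J ∈ (vectorSpan ℝ F)ᗮ := mem_orthogonal_vectorSpan hJ1
    rw [hspan, h.orthogonal_vectorSpan_facet, Submodule.mem_span_singleton] at hm
    obtain ⟨a, ha⟩ := hm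
    obtain ⟨x, hx⟩ := hne
    have h1 := hJ1 x hx
    rw [← ha, inner_smul_right, (hsub hx).2, mul_one] at h1
    rw [h1, one_smul] at ha
    exact (h.injective ha).symm
  refine ⟨I, hsub.antisymm fun x hx => (hmem x).2 ⟨hx.1, fun J hJ => ?_⟩⟩
  rw [huniq J hJ]
  exact hx.2

/-- The elements of `Q` correspond to the facets of `P`. -/
noncomputable def facetEquiv : Q ≃ {F : Set E // IsFacet P F} :=
  Equiv.ofBijective (fun I => ⟨h.facet I, h.isFacet_facet I⟩)
    ⟨fun _ _ hIJ => h.facet_injective (congrArg Subtype.val hIJ),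
      fun F => (h.exists_eq_facet F.2).imp fun _ hI => Subtype.ext hI.symm⟩

end IsPolarSystem

end PolarSystem


/-! ### Largest sums over subsets of a given size. -/

section UpperSets

/-- A strictly monotone function has its largest sum over the sets of a given size at the upper
set of that size, and only there. -/
theorem sum_le_sum_of_upper {ι : Type*} [LinearOrder ι] {f : ι → ℝ} (hf : StrictMono f)
    {A B : Finset ι} (hcard : B.card = A.card) (hA : ∀ a ∈ A, ∀ b ∉ A, b < a) :
    ∑ i ∈ B, f i ≤ ∑ i ∈ A, f i ∧ (∑ i ∈ B, f i = ∑ i ∈ A, f i → B = A) := by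
  have hcard' : (B \ A).card = (A \ B).card := Finset.card_sdiff_comm hcard
  have hA' := Finset.sum_sdiff_sub_sum_sdiff (s₁ := A) (s₂ := B) (f := f)
  rcases (A \ B).eq_empty_or_nonempty with he | hne
  · have : B = A :=
      (Finset.eq_of_subset_of_card_le (Finset.sdiff_eq_empty_iff_subset.1 he) hcard.le).symm
    simp [this]
  · obtain ⟨a, ha, hmin⟩ := Finset.exists_min_image _ f hne
    have h1 : ∑ i ∈ B \ A, f i < ∑ i ∈ B \ A, f a := by
      refine Finset.sum_lt_sum_of_nonempty ?_ fun b hb => hf ?_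
      · rw [← Finset.card_pos, hcard', Finset.card_pos]; exact hne
      · exact hA a (Finset.mem_sdiff.1 ha).1 b (Finset.mem_sdiff.1 hb).2
    have h2 : ∑ i ∈ A \ B, f a ≤ ∑ i ∈ A \ B, f i := Finset.sum_le_sum hmin
    rw [Finset.sum_const] at h1 h2
    rw [hcard'] at h1
    have h3 : ∑ i ∈ B, f i < ∑ i ∈ A, f i := by linarith
    exact ⟨h3.le, fun heq => absurd heq h3.ne⟩

/-- The `k` largest elements of `Fin n`. -/
def topSet (n k : ℕ) : Finset (Fin n) := Finset.univ.filter fun i => n ≤ (i : ℕ) + k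

theorem card_topSet {n k : ℕ} (hk : k ≤ n) : (topSet n k).card = k := by
  have : (topSet n k).map Fin.valEmbedding = Finset.Ico (n - k) n := by
    ext j
    simp only [topSet, Finset.mem_map, Finset.mem_filter, Finset.mem_univ, true_and,
      Fin.valEmbedding_apply, Finset.mem_Ico]
    constructor
    · rintro ⟨i, hi, rfl⟩
      omega
    · rintro ⟨h1, h2⟩
      exact ⟨⟨j, h2⟩, by simp only; omega, rfl⟩
  rw [← Finset.card_map Fin.valEmbedding, this, Nat.card_Ico]
  omega

theorem topSet_upper {n k : ℕ} : ∀ a ∈ topSet n k, ∀ b ∉ topSet n k, b < a := by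
  intro a ha b hb
  simp only [topSet, Finset.mem_filter, Finset.mem_univ, true_and] at ha hb
  rw [Fin.lt_def]
  omega

/-- The sum of the `k` largest of the numbers `1, …, n`. -/
noncomputable def topSum (n k : ℕ) : ℝ := ∑ i ∈ topSet n k, (((i : ℕ) : ℝ) + 1)

theorem strictMono_val_add_one (n : ℕ) : StrictMono fun i : Fin n => ((i : ℕ) : ℝ) + 1 :=
  fun i j hij => by simpa using hij

theorem topSum_pos {n k : ℕ} (hk : 0 < k) (hkn : k ≤ n) : 0 < topSum n k := by
  refine Finset.sum_pos (fun i _ => by positivity) ?_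
  rwa [← Finset.card_pos, card_topSet hkn]

theorem sum_le_topSum {n : ℕ} (B : Finset (Fin n)) :
    ∑ i ∈ B, (((i : ℕ) : ℝ) + 1) ≤ topSum n B.card :=
  (sum_le_sum_of_upper (strictMono_val_add_one n)
    (card_topSet (card_finset_fin_le B)).symm topSet_upper).1

theorem sum_eq_topSum_iff {n : ℕ} (B : Finset (Fin n)) :
    ∑ i ∈ B, (((i : ℕ) : ℝ) + 1) = topSum n B.card ↔ ∀ a ∈ B, ∀ b ∉ B, b < a := by
  have hcard := card_topSet (card_finset_fin_le B)
  constructor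
  · intro heq
    rw [(sum_le_sum_of_upper (strictMono_val_add_one n) hcard.symm topSet_upper).2 heq]
    exact topSet_upper
  · intro hB
    exact le_antisymm (sum_le_topSum B)
      (sum_le_sum_of_upper (strictMono_val_add_one n) hcard hB).1

end UpperSets

/-! ### Sign vectors as functionals on signed permutations. -/

section SignVectors

variable {n : ℕ}

/-- The support of a sign vector. -/
def signSupport (s : Fin n → SignType) : Finset (Fin n) := Finset.univ.filter fun i => s i ≠ 0

@[simp]
theorem mem_signSupport {s : Fin n → SignType} {i : Fin n} : i ∈ signSupport s ↔ s i ≠ 0 := by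
  simp [signSupport]

theorem signSupport_nonempty {s : Fin n → SignType} (hs : s ≠ 0) : (signSupport s).Nonempty := by
  obtain ⟨i, hi⟩ := Function.ne_iff.1 hs
  exact ⟨i, mem_signSupport.2 hi⟩

/-- A sign vector as a point of Euclidean space. -/
noncomputable def signVector (s : Fin n → SignType) : EuclideanSpace ℝ (Fin n) :=
  WithLp.toLp 2 fun i => ((s i : SignType) : ℝ)

/-- A vertex of the type `B` permutohedron. -/
noncomputable def signedPermPoint (π : Equiv.Perm (Fin n)) (ε : Fin n → ℤˣ) :
    EuclideanSpace ℝ (Fin n) :=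
  WithLp.toLp 2 fun i => ((ε i : ℤ) : ℝ) * (((π i : ℕ) : ℝ) + 1)

theorem signedPermPoint_mem (π : Equiv.Perm (Fin n)) (ε : Fin n → ℤˣ) :
    signedPermPoint π ε ∈ permB n :=
  subset_convexHull ℝ _ ⟨π, ε, fun _ => rfl⟩

theorem inner_signedPermPoint (π : Equiv.Perm (Fin n)) (ε : Fin n → ℤˣ) (s : Fin n → SignType) :
    ⟪signedPermPoint π ε, signVector s⟫ =
      ∑ i ∈ signSupport s, ((s i : SignType) : ℝ) * ((ε i : ℤ) : ℝ) * (((π i : ℕ) : ℝ) + 1) := by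
  rw [signSupport, Finset.sum_filter, PiLp.inner_apply]
  refine Finset.sum_congr rfl fun i _ => ?_
  simp only [signedPermPoint, signVector, RCLike.inner_apply, conj_trivial]
  split_ifs with h
  · ring
  · simp [not_not.1 h]

theorem sign_mul_unit_le_one (a : SignType) (e : ℤˣ) : (a : ℝ) * ((e : ℤ) : ℝ) ≤ 1 := by
  rcases Int.units_eq_one_or e with rfl | rfl <;> cases a <;> norm_num

theorem exists_unit_sign_mul_eq_one {a : SignType} (ha : a ≠ 0) :
    ∃ e : ℤˣ, (a : ℝ) * ((e : ℤ) : ℝ) = 1 := by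
  cases a
  · exact absurd rfl ha
  · exact ⟨-1, by simp⟩
  · exact ⟨1, by simp⟩

theorem exists_unit_sign_mul_ne_one (a : SignType) : ∃ e : ℤˣ, (a : ℝ) * ((e : ℤ) : ℝ) ≠ 1 := by
  cases a
  · exact ⟨1, by simp⟩
  · exact ⟨1, by norm_num⟩
  · exact ⟨-1, by norm_num⟩

theorem sign_eq_of_mul_unit {a b : SignType} {e : ℤˣ} (ha : (a : ℝ) * ((e : ℤ) : ℝ) = 1)
    (hb : (b : ℝ) * ((e : ℤ) : ℝ) = 1) : a = b := by
  rcases Int.units_eq_one_or e with rfl | rfl <;> cases a <;> cases b <;> norm_num at *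

/-- Two bounds are chained: each sign product is at most 1, and the values of `π` on the support sum
to at most `topSum`. Equality holds exactly when both are tight: the signs agree and the support
receives the largest values. -/
theorem inner_signedPermPoint_le_and_eq_iff (π : Equiv.Perm (Fin n)) (ε : Fin n → ℤˣ)
    (s : Fin n → SignType) :
    ⟪signedPermPoint π ε, signVector s⟫ ≤ topSum n (signSupport s).card ∧
    (⟪signedPermPoint π ε, signVector s⟫ = topSum n (signSupport s).card ↔
      (∀ i, s i ≠ 0 → ((s i : SignType) : ℝ) * ((ε i : ℤ) : ℝ) = 1) ∧
      ∀ i j, s i ≠ 0 → s j = 0 → π j < π i) := by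
  have hterm : ∀ i ∈ signSupport s, ((s i : SignType) : ℝ) * ((ε i : ℤ) : ℝ) *
      (((π i : ℕ) : ℝ) + 1) ≤ ((π i : ℕ) : ℝ) + 1 := fun i _ =>
    mul_le_of_le_one_left (by positivity) (sign_mul_unit_le_one _ _)
  have h1 := Finset.sum_le_sum hterm
  have h1' := Finset.sum_eq_sum_iff_of_le hterm
  have hmap : ∑ i ∈ signSupport s, (((π i : ℕ) : ℝ) + 1) =
      ∑ j ∈ (signSupport s).map π.toEmbedding, (((j : ℕ) : ℝ) + 1) := by
    rw [Finset.sum_map]; rfl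
  have h2 := sum_le_topSum ((signSupport s).map π.toEmbedding)
  have h2' := sum_eq_topSum_iff ((signSupport s).map π.toEmbedding)
  rw [Finset.card_map, ← hmap] at h2 h2'
  rw [inner_signedPermPoint]
  have hone : (∀ i ∈ signSupport s, ((s i : SignType) : ℝ) * ((ε i : ℤ) : ℝ) *
      (((π i : ℕ) : ℝ) + 1) = ((π i : ℕ) : ℝ) + 1) ↔
      ∀ i, s i ≠ 0 → ((s i : SignType) : ℝ) * ((ε i : ℤ) : ℝ) = 1 := by
    refine forall_congr' fun i => ?_
    rw [mem_signSupport]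
    refine imp_congr_right fun _ => ?_
    rw [mul_eq_right₀ (by positivity)]
  have htwo : (∀ a ∈ (signSupport s).map π.toEmbedding,
      ∀ b ∉ (signSupport s).map π.toEmbedding, b < a) ↔
      ∀ i j, s i ≠ 0 → s j = 0 → π j < π i := by
    constructor
    · intro h i j hi hj
      exact h _ (Finset.mem_map_of_mem _ (mem_signSupport.2 hi)) _ (by simp [hj])
    · intro h a ha b hb
      obtain ⟨i, hi, rfl⟩ := Finset.mem_map.1 ha
      obtain ⟨j, rfl⟩ := π.surjective b
      exact h i j (mem_signSupport.1 hi) (by simpa using hb)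
  refine ⟨h1.trans h2, ?_⟩
  rw [← hone, ← htwo, ← h1', ← h2']
  constructor
  · intro h
    exact ⟨le_antisymm h1 (h ▸ h2), le_antisymm h2 (h ▸ h1)⟩
  · rintro ⟨h, h'⟩
    rw [h, h']

end SignVectors

/-! ### Intervals as sign vectors, and the polar system of the type B permutohedron. -/

section ProperInterval

variable {n : ℕ}

/-- The bounds of a proper interval. -/
def ProperInterval.bounds (I : ProperInterval n) : NonemptyInterval (Finset (Fin n)) :=
  WithBot.unbot I.1 I.2.1

theorem ProperInterval.coe_bounds (I : ProperInterval n) :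
    ((I.bounds : NonemptyInterval (Finset (Fin n))) : Interval (Finset (Fin n))) = I.1 :=
  WithBot.coe_unbot _ _

/-- The sign vector of an interval `[X, Y]`: it is `1` on `X`, `0` on `Y \ X`, and `-1` off `Y`. -/
def intervalSign (I : ProperInterval n) (i : Fin n) : SignType :=
  if i ∈ I.bounds.fst then 1 else if i ∈ I.bounds.snd then 0 else -1

/-- Elements of sign 0 are those free to be in or out of a set of the interval. Shrinking the
interval keeps the decisions already made and may add new ones. -/
theorem intervalSign_le_iff (I J : ProperInterval n) :
    I ≤ J ↔ ∀ i, intervalSign J i ≠ 0 → intervalSign I i = intervalSign J i := by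
  rw [← Subtype.coe_le_coe, ← I.coe_bounds, ← J.coe_bounds, Interval.coe_le_coe,
    NonemptyInterval.le_def]
  have hI := I.bounds.fst_le_snd
  have hJ := J.bounds.fst_le_snd
  simp only [Finset.subset_iff] at *
  rw [← forall_and]
  refine forall_congr' fun i => ?_
  have hI := @hI i
  have hJ := @hJ i
  unfold intervalSign
  by_cases h1 : i ∈ I.bounds.fst <;> by_cases h2 : i ∈ I.bounds.snd <;>
    by_cases h3 : i ∈ J.bounds.fst <;> by_cases h4 : i ∈ J.bounds.snd <;>
    simp_all

theorem intervalSign_injective : Function.Injective (intervalSign (n := n)) := fun I J h =>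
  le_antisymm ((intervalSign_le_iff I J).2 fun i _ => by rw [h])
    ((intervalSign_le_iff J I).2 fun i _ => by rw [h])

theorem intervalSign_ne_zero (I : ProperInterval n) : intervalSign I ≠ 0 := by
  intro h
  have hI := I.bounds.fst_le_snd
  refine I.2.2 ?_
  rw [← I.coe_bounds, Interval.coe_inj]
  have key : ∀ i, i ∉ I.bounds.fst ∧ i ∈ I.bounds.snd := fun i => by
    have := congrFun h i
    unfold intervalSign at this
    split_ifs at this
    simp_all
  ext i
  · simpa using (key i).1
  · simpa using (key i).2

theorem exists_intervalSign_eq {s : Fin n → SignType} (hs : s ≠ 0) :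
    ∃ I : ProperInterval n, intervalSign I = s := by
  let b : NonemptyInterval (Finset (Fin n)) :=
    ⟨(Finset.univ.filter fun i => s i = 1, Finset.univ.filter fun i => s i ≠ -1),
      fun i hi => by
        simp only [Finset.mem_filter, Finset.mem_univ, true_and] at hi ⊢
        rw [hi]; decide⟩
  refine ⟨⟨(b : Interval (Finset (Fin n))), WithBot.coe_ne_bot, fun h => hs ?_⟩, ?_⟩
  · rw [Interval.coe_inj] at h
    have h1 := congrArg (fun c : NonemptyInterval (Finset (Fin n)) => c.fst) h
    have h2 := congrArg (fun c : NonemptyInterval (Finset (Fin n)) => c.snd) h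
    funext i
    have h1i : i ∉ b.fst := by rw [show b.fst = ∅ from h1]; simp
    have h2i : i ∈ b.snd := by rw [show b.snd = Finset.univ from h2]; simp
    simp only [b, Finset.mem_filter, Finset.mem_univ, true_and] at h1i h2i
    simp only [Pi.zero_apply]
    cases hsi : s i <;> simp_all
  · funext i
    change (if i ∈ b.fst then (1 : SignType) else if i ∈ b.snd then 0 else -1) = s i
    simp only [b, Finset.mem_filter, Finset.mem_univ, true_and]
    cases hsi : s i <;> decide

instance : Finite (ProperInterval n) := Finite.of_injective _ intervalSign_injective

noncomputable instance : Fintype (ProperInterval n) := Fintype.ofFinite _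

/-- The maximum over the type `B` permutohedron of the functional of an interval. -/
noncomputable def intervalHeight (I : ProperInterval n) : ℝ :=
  topSum n (signSupport (intervalSign I)).card

theorem intervalHeight_pos (I : ProperInterval n) : 0 < intervalHeight I :=
  topSum_pos (signSupport_nonempty (intervalSign_ne_zero I)).card_pos (card_finset_fin_le _)

/-- The vertices of the dual of the type `B` permutohedron. -/
noncomputable def dualVertex (I : ProperInterval n) : EuclideanSpace ℝ (Fin n) :=
  (intervalHeight I)⁻¹ • signVector (intervalSign I)

theorem inner_signedPermPoint_dualVertex_le (π : Equiv.Perm (Fin n)) (ε : Fin n → ℤˣ)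
    (I : ProperInterval n) : ⟪signedPermPoint π ε, dualVertex I⟫ ≤ 1 := by
  rw [dualVertex, inner_smul_right, inv_mul_le_iff₀ (intervalHeight_pos I), mul_one]
  exact (inner_signedPermPoint_le_and_eq_iff π ε _).1

theorem inner_signedPermPoint_dualVertex_eq_iff (π : Equiv.Perm (Fin n)) (ε : Fin n → ℤˣ)
    (I : ProperInterval n) : ⟪signedPermPoint π ε, dualVertex I⟫ = 1 ↔
      (∀ i, intervalSign I i ≠ 0 →
        ((intervalSign I i : SignType) : ℝ) * ((ε i : ℤ) : ℝ) = 1) ∧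
      ∀ i j, intervalSign I i ≠ 0 → intervalSign I j = 0 → π j < π i := by
  rw [dualVertex, inner_smul_right, inv_mul_eq_one₀ (intervalHeight_pos I).ne', eq_comm]
  exact (inner_signedPermPoint_le_and_eq_iff π ε _).2

theorem inner_dualVertex_le_one {x : EuclideanSpace ℝ (Fin n)} (hx : x ∈ permB n)
    (I : ProperInterval n) : ⟪x, dualVertex I⟫ ≤ 1 := by
  have hconv : Convex ℝ {x : EuclideanSpace ℝ (Fin n) | ⟪x, dualVertex I⟫ ≤ 1} := by
    intro y hy z hz a b ha hb hab
    simp only [Set.mem_ofPred_eq] at hy hz ⊢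
    rw [inner_add_left, real_inner_smul_left, real_inner_smul_left]
    nlinarith
  refine convexHull_min ?_ hconv hx
  rintro y ⟨π, ε, hy⟩
  have : y = signedPermPoint π ε := by ext i; exact hy i
  rw [this]
  exact inner_signedPermPoint_dualVertex_le π ε I

/-- A permutation that sorts a given function. -/
theorem exists_perm_lt_of_lt (key : Fin n → ℕ) :
    ∃ π : Equiv.Perm (Fin n), ∀ i j, key i < key j → π i < π j := by
  refine ⟨(Tuple.sort key).symm, fun i j hij => ?_⟩
  by_contra! hle
  have := Tuple.monotone_sort key hle
  simp only [Function.comp_apply, Equiv.apply_symm_apply] at this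
  omega

/-- Given a chain and an interval `J` outside of it, some vertex of the type `B` permutohedron
maximizes the functionals of the chain, but not that of `J`. -/
theorem exists_signedPermPoint {C : Set (ProperInterval n)} (hC : IsChain (· ≤ ·) C)
    (J : ProperInterval n) : ∃ (π : Equiv.Perm (Fin n)) (ε : Fin n → ℤˣ),
      (∀ I ∈ C, ⟪signedPermPoint π ε, dualVertex I⟫ = 1) ∧
      (⟪signedPermPoint π ε, dualVertex J⟫ = 1 → J ∈ C) := by
  classical
  have hsgn : ∀ I ∈ C, ∀ K ∈ C, ∀ i, intervalSign I i ≠ 0 → intervalSign K i ≠ 0 →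
      intervalSign I i = intervalSign K i := by
    intro I hI K hK i hi hi'
    rcases hC.total hI hK with hle | hle
    · exact (intervalSign_le_iff _ _).1 hle i hi'
    · exact ((intervalSign_le_iff _ _).1 hle i hi).symm
  have hε : ∀ i, ∃ e : ℤˣ, (∀ I ∈ C, intervalSign I i ≠ 0 →
      ((intervalSign I i : SignType) : ℝ) * ((e : ℤ) : ℝ) = 1) ∧
      ((∀ I ∈ C, intervalSign I i = 0) →
        ((intervalSign J i : SignType) : ℝ) * ((e : ℤ) : ℝ) ≠ 1) := by
    intro i
    by_cases hex : ∃ I ∈ C, intervalSign I i ≠ 0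
    · obtain ⟨I, hI, hi⟩ := hex
      obtain ⟨e, he⟩ := exists_unit_sign_mul_eq_one hi
      exact ⟨e, fun K hK hi' => hsgn I hI K hK i hi hi' ▸ he, fun hall => absurd (hall I hI) hi⟩
    · push Not at hex
      -- At coordinates that the chain leaves free, the sign is chosen to spoil `J`.
      obtain ⟨e, he⟩ := exists_unit_sign_mul_ne_one (intervalSign J i)
      exact ⟨e, fun K hK hi' => absurd (hex K hK) hi', fun _ => he⟩
  choose ε hεC hεJ using hε
  let cnt : Fin n → Finset (ProperInterval n) := fun i =>
    Finset.univ.filter fun I => I ∈ C ∧ intervalSign I i ≠ 0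
  have mem_cnt : ∀ i I, I ∈ cnt i ↔ I ∈ C ∧ intervalSign I i ≠ 0 := by simp [cnt]
  have hcnt : ∀ I ∈ C, ∀ i j, intervalSign I i ≠ 0 → intervalSign I j = 0 →
      (cnt j).card < (cnt i).card := by
    intro I hI i j hi hj
    refine Finset.card_lt_card ((Finset.ssubset_iff_of_subset fun K hK => ?_).2
      ⟨I, (mem_cnt i I).2 ⟨hI, hi⟩, fun hmem => ((mem_cnt j I).1 hmem).2 hj⟩)
    rw [mem_cnt] at hK ⊢
    refine ⟨hK.1, ?_⟩
    rcases hC.total hI hK.1 with hle | hle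
    · have := (intervalSign_le_iff _ _).1 hle j hK.2
      exact absurd (this ▸ hj) hK.2
    · rw [(intervalSign_le_iff _ _).1 hle i hi]
      exact hi
  -- The supports of the chain are nested, so sorting by `cnt` maximizes the whole chain. The factor
  -- 2 keeps this order primary; ties are broken against `J`, with its zero coordinates placed
  -- higher.
  obtain ⟨π, hπ⟩ := exists_perm_lt_of_lt fun i =>
    2 * (cnt i).card + if intervalSign J i = 0 then 1 else 0
  refine ⟨π, ε, fun I hI => ?_, fun hJ => ?_⟩
  · rw [inner_signedPermPoint_dualVertex_eq_iff]
    refine ⟨fun i => hεC i I hI, fun i j hi hj => hπ j i ?_⟩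
    have := hcnt I hI i j hi hj
    split_ifs <;> omega
  · rw [inner_signedPermPoint_dualVertex_eq_iff] at hJ
    obtain ⟨hJs, hJπ⟩ := hJ
    have hJlt : ∀ i j, intervalSign J i ≠ 0 → intervalSign J j = 0 →
        (cnt j).card < (cnt i).card := by
      intro i j hi hj
      by_contra! hle
      have := hπ i j (by rw [if_neg hi, if_pos hj]; omega)
      exact lt_asymm this (hJπ i j hi hj)
    obtain ⟨i₀, hi₀, hmin⟩ := Finset.exists_min_image _ (fun i => (cnt i).card)
      (signSupport_nonempty (intervalSign_ne_zero J))
    rw [mem_signSupport] at hi₀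
    have hne : (cnt i₀).Nonempty := by
      by_contra hemp
      refine hεJ i₀ (fun I hI => ?_) (hJs i₀ hi₀)
      by_contra hi
      exact hemp ⟨I, (mem_cnt i₀ I).2 ⟨hI, hi⟩⟩
    -- The largest interval of the chain with `i₀` in its support has the smallest such support. The
    -- minimality of `i₀` and the strict inequalities `hJlt` make this support equal to that of `J`.
    obtain ⟨I₀, hI₀⟩ := (cnt i₀).exists_maximal hne
    obtain ⟨hI₀C, hI₀i⟩ := (mem_cnt i₀ I₀).1 hI₀.prop
    have hsupp : ∀ i, intervalSign I₀ i ≠ 0 ↔ intervalSign J i ≠ 0 := by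
      intro i
      constructor
      · intro hi hJi
        have hlt := hJlt i₀ i hi₀ hJi
        obtain ⟨I, hI, hIi⟩ := Finset.exists_mem_notMem_of_card_lt_card hlt
        have hle : I ≤ I₀ := by
          rcases hC.total ((mem_cnt i₀ I).1 hI).1 hI₀C with hle | hle
          · exact hle
          · exact hI₀.le_of_ge hI hle
        refine hIi ((mem_cnt i I).2 ⟨((mem_cnt i₀ I).1 hI).1, ?_⟩)
        rw [(intervalSign_le_iff _ _).1 hle i hi]
        exact hi
      · intro hJi hi
        have h1 := hcnt I₀ hI₀C i₀ i hI₀i hi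
        have h2 := hmin i (mem_signSupport.2 hJi)
        omega
    have : I₀ = J := by
      refine intervalSign_injective (funext fun i => ?_)
      by_cases hi : intervalSign J i = 0
      · rw [hi]
        by_contra hi'
        exact (hsupp i).1 hi' hi
      · exact sign_eq_of_mul_unit (hεC i I₀ hI₀C ((hsupp i).2 hi)) (hJs i hi)
    exact this ▸ hI₀C

/-- Average the vertices supplied by `exists_signedPermPoint` over all `J`. An average of numbers at
most 1 equals 1 only if each does, and the vertex chosen for `J` rules out `J` unless it is in `C`.
-/
theorem exists_supporting_permB {C : Set (ProperInterval n)} (hC : IsChain (· ≤ ·) C) :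
    ∃ x ∈ permB n, ∀ I, ⟪x, dualVertex I⟫ = 1 ↔ I ∈ C := by
  -- With no proper intervals there is nothing to average, and any vertex serves.
  rcases isEmpty_or_nonempty (ProperInterval n) with hemp | hne
  · exact ⟨signedPermPoint 1 1, signedPermPoint_mem _ _, fun I => hemp.elim I⟩
  choose π ε hCe hJ using exists_signedPermPoint hC
  have hpos : (0 : ℝ) < (Fintype.card (ProperInterval n) : ℝ)⁻¹ :=
    inv_pos.2 (Nat.cast_pos.2 Fintype.card_pos)
  have hsum : ∑ _J : ProperInterval n, (Fintype.card (ProperInterval n) : ℝ)⁻¹ = 1 := by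
    simp
  have hinner : ∀ I : ProperInterval n,
      ⟪∑ J, (Fintype.card (ProperInterval n) : ℝ)⁻¹ • signedPermPoint (π J) (ε J), dualVertex I⟫ =
      ∑ J, (Fintype.card (ProperInterval n) : ℝ)⁻¹ *
        ⟪signedPermPoint (π J) (ε J), dualVertex I⟫ := fun I => by
    rw [sum_inner]
    simp only [real_inner_smul_left]
  refine ⟨_, (convex_convexHull ℝ _).sum_mem (fun J _ => hpos.le) hsum
    fun J _ => signedPermPoint_mem (π J) (ε J), fun I => ?_⟩
  rw [hinner]
  constructor
  · intro h
    refine hJ I (eq_of_le_sum_mul (fun _ => hpos.le)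
      (fun J => inner_signedPermPoint_dualVertex_le (π J) (ε J) I) ?_ hpos.ne')
    rw [h, hsum, mul_one]
  · intro hI
    rw [← hsum]
    exact Finset.sum_congr rfl fun J _ => by rw [hCe J I hI, mul_one]

/-- Moving `y` towards 0 by at most `|y|` never crosses 0. -/
theorem sign_sub_mul_sign {y m : ℝ} (hmy : m ≤ |y|) :
    SignType.sign (y - m * SignType.sign y) ≠ 0 →
      SignType.sign (y - m * SignType.sign y) = SignType.sign y := by
  rcases lt_trichotomy y 0 with hy | rfl | hy
  · rw [abs_of_neg hy] at hmy
    rw [sign_neg hy]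
    intro h
    have h' : y - m * ((-1 : SignType) : ℝ) ≠ 0 := sign_ne_zero.1 h
    rw [sign_neg]
    refine lt_of_le_of_ne ?_ h'
    simp only [SignType.coe_neg_one]
    linarith
  · simp
  · rw [abs_of_pos hy] at hmy
    rw [sign_pos hy]
    intro h
    have h' : y - m * ((1 : SignType) : ℝ) ≠ 0 := sign_ne_zero.1 h
    rw [sign_pos]
    refine lt_of_le_of_ne ?_ h'.symm
    simp only [SignType.coe_one]
    linarith

/-- Every vector is a nonnegative combination of the sign vectors of a chain, obtained
by cutting it into layers. -/
theorem exists_coeff_signVector (y : EuclideanSpace ℝ (Fin n)) :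
    ∃ c : ProperInterval n → ℝ, (∀ I, 0 ≤ c I) ∧ IsChain (· ≤ ·) {I | c I ≠ 0} ∧
      (∀ I, c I ≠ 0 → ∀ i, intervalSign I i ≠ 0 → intervalSign I i = SignType.sign (y i)) ∧
      ∑ I, c I • signVector (intervalSign I) = y := by
  classical
  induction hk : (signSupport fun i => SignType.sign (y i)).card using Nat.strong_induction_on
    generalizing y with
  | _ k ih =>
  by_cases hs : (fun i => SignType.sign (y i)) = 0
  · refine ⟨0, by simp, by simp [IsChain], by simp, ?_⟩
    ext i
    have := congrFun hs i
    simp only [Pi.zero_apply, sign_eq_zero_iff] at this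
    simp [this]
  -- The layer removed is the full sign pattern of `y`, with the smallest nonzero `|y j|` as
  -- coefficient. This kills coordinate `j` and reverses no sign, so the support shrinks and `I₀`
  -- lies below every later interval.
  obtain ⟨I₀, hI₀⟩ := exists_intervalSign_eq hs
  obtain ⟨j, hj, hmin⟩ := Finset.exists_min_image _ (fun i => |y i|) (signSupport_nonempty hs)
  rw [mem_signSupport, sign_ne_zero] at hj
  have hm : 0 < |y j| := abs_pos.2 hj
  set y' : EuclideanSpace ℝ (Fin n) := y - |y j| • signVector (intervalSign I₀) with hy'
  have hy'i : ∀ i, y' i = y i - |y j| * SignType.sign (y i) := fun i => by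
    simp [hy', hI₀, signVector]
  have hsign : ∀ i, SignType.sign (y' i) ≠ 0 → SignType.sign (y' i) = SignType.sign (y i) := by
    intro i
    by_cases hi : y i = 0
    · rw [hy'i, hi]; simp
    · rw [hy'i]
      exact sign_sub_mul_sign (hmin i (by simpa using hi))
  have hlt : (signSupport fun i => SignType.sign (y' i)).card < k := by
    rw [← hk]
    refine Finset.card_lt_card ((Finset.ssubset_iff_of_subset fun i hi => ?_).2 ⟨j, ?_, ?_⟩)
    · rw [mem_signSupport] at hi ⊢
      rw [← hsign i hi]
      exact hi
    · simpa using hj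
    · rw [mem_signSupport, not_not, hy'i, mul_comm, sign_mul_abs, sub_self, sign_zero]
  obtain ⟨c, hc, hC, hcs, hsum⟩ := ih _ hlt y' rfl
  have hle : ∀ I, c I ≠ 0 → I₀ ≤ I := fun I hI => by
    rw [intervalSign_le_iff]
    intro i hi
    have h1 := hcs I hI i hi
    rw [hI₀, h1, hsign i (h1 ▸ hi)]
  have hor : ∀ I, (c + Pi.single I₀ |y j| : ProperInterval n → ℝ) I ≠ 0 → I = I₀ ∨ c I ≠ 0 := fun I hI => by
    by_contra! hcon
    exact hI (by simp [hcon.1, hcon.2])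
  refine ⟨c + Pi.single I₀ |y j|, fun I => ?_, ?_, fun I hI i hi => ?_, ?_⟩
  · have h1 := hc I
    have h2 : 0 ≤ (Pi.single I₀ |y j| : ProperInterval n → ℝ) I :=
      (Pi.single_nonneg.2 hm.le : (0 : ProperInterval n → ℝ) ≤ _) I
    exact add_nonneg h1 h2
  · refine (hC.insert (a := I₀) fun I hI _ => Or.inl (hle I hI)).mono fun I hI => ?_
    exact hor I hI
  · rcases hor I hI with rfl | hI'
    · rw [hI₀]
    · have h1 := hcs I hI' i hi
      rw [h1, hsign i (h1 ▸ hi)]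
  · simp only [Pi.add_apply, add_smul, Finset.sum_add_distrib, hsum]
    rw [Finset.sum_eq_single I₀ (fun I _ hI => by simp [hI]) (by simp), Pi.single_eq_same, hy']
    abel

theorem isPolarSystem_permB : IsPolarSystem (permB n) (dualVertex (n := n)) where
  inner_le_one _ hx I := inner_dualVertex_le_one hx I
  exists_supporting _ hC := exists_supporting_permB hC
  exists_coeff y := by
    obtain ⟨c, hc, hC, -, hsum⟩ := exists_coeff_signVector y
    refine ⟨fun I => c I * intervalHeight I, fun I => mul_nonneg (hc I) (intervalHeight_pos I).le,
      hC.mono fun I hI => left_ne_zero_of_mul hI, ?_⟩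
    rw [← hsum]
    refine Finset.sum_congr rfl fun I _ => ?_
    rw [dualVertex, smul_smul, mul_assoc, mul_inv_cancel₀ (intervalHeight_pos I).ne', mul_one]

end ProperInterval

theorem mainTheorem3 (n : ℕ) :
    IsSimplicialPolytope (dualPolytope (permB n)) ∧
    (∃ K : Geometry.SimplicialComplex ℝ (EuclideanSpace ℝ (Fin n)),
      IsBoundaryComplex (dualPolytope (permB n)) K ∧
      CombinatoriallyEquivalent K.toPreAbstractSimplicialComplex
        (orderComplex (ProperInterval n)).toPreAbstractSimplicialComplex) ∧
    (∃ facet : ProperInterval n ≃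
        {F : Set (EuclideanSpace ℝ (Fin n)) // IsFacet (permB n) F},
      ∀ S : Finset (ProperInterval n),
        (⋂ I ∈ S, (facet I : Set (EuclideanSpace ℝ (Fin n)))).Nonempty ↔
          IsChain (· ≤ ·) (S : Set (ProperInterval n))) :=
  ⟨isPolarSystem_permB.isSimplicialPolytope_dual,
    ⟨isPolarSystem_permB.boundaryComplex, isPolarSystem_permB.isBoundaryComplex_boundaryComplex,
      isPolarSystem_permB.combinatoriallyEquivalent⟩,
    isPolarSystem_permB.facetEquiv, isPolarSystem_permB.iInter_facet_nonempty_iff⟩
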